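/- Let $\mathbb{P}=\{1,2,3,\dots\}$, $[k]=\{1,\dots,k\}$, let $m,n\ge 0$, fix $s\in\mathbb{P}^m$ and put $\mathcal{S}=[s_1]\times\cdots\times[s_m]$. For $r\in\mathbb{P}^n$ put $R_r=[r_1]\times\cdots\times[r_n]$, let $\Delta_{\mathcal{S}\times R_r}\subseteq\mathbb{R}^{\mathcal{S}\times R_r}$ be the simplex of probability distributions $p$ of random vectors $(Y,Z)=(Y_1,\dots,Y_m,Z_1,\dots,Z_n)$ with state space $\mathcal{S}\times R_r$, and let $\mathbb{R}[X_{\mathcal{S}\times R_r}]$ be the polynomial ring with one indeterminate $x_{y,z}$ for each $(y,z)\in\mathcal{S}\times R_r$. For $r\le r'$ (componentwise) regard $\mathbb{R}[X_{\mathcal{S}\times R_r}]\subseteq\mathbb{R}[X_{\mathcal{S}\times R_{r'}}]$ via $R_r\subseteq R_{r'}$. The group $\mathfrak{S}_{r_1}\times\cdots\times\mathfrak{S}_{r_n}$ acts on $\mathbb{R}[X_{\mathcal{S}\times R_r}]$ by $\sigma\cdot x_{y,(z_1,\dots,z_n)}=x_{y,(\sigma_1(z_1),\dots,\sigma_n(z_n))}$.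 **Theorem.** For each $r\in\mathbb{P}^n$ let $\mathcal{M}_r\subseteq\Delta_{\mathcal{S}\times R_r}$ be a statistical model (an arbitrary subset), and let $I_r=\mathcal{I}^h(\mathcal{M}_r)\subseteq\mathbb{R}[X_{\mathcal{S}\times R_r}]$ be its homogeneous vanishing ideal, that is, the ideal generated by all homogeneous polynomials that vanish on $\mathcal{M}_r$. Suppose that 1. each $I_r$ is stable under the action of $\mathfrak{S}_{r_1}\times\cdots\times\mathfrak{S}_{r_n}$; 2. $I_r\subseteq I_{r+t}$ for all $r\in\mathbb{P}^n$ and $t\in\mathbb{N}^n$; 3. every $p\in\mathcal{M}_r$, for every $r$, satisfies the conditional independence constraint $Z_1\perp\!\!\!\perp Z_2\perp\!\!\!\perp\cdots\perp\!\!\!\perp Z_n\mid Y$, that is, $P(Z=z\mid Y=y)=\prod_{j=1}^n P(Z_j=z_j\mid Y=y)$ for all $z\in R_r$ and all $y\in\mathcal{S}$ with $P(Y=y)>0$. Then the ideals $I_r$ have a finite symmetric generating set as $r_1,\dots,r_n\to\infty$: there are $r_0\in\mathbb{P}^n$ and a finite set $F\subseteq I_{r_0}$ such that for every $r\in\mathbb{P}^n$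 with $r\ge r_0$ componentwise, $$I_r=\bigl\langle\, \sigma\cdot f \;:\; \sigma\in\mathfrak{S}_{r_1}\times\cdots\times\mathfrak{S}_{r_n},\ f\in F \,\bigr\rangle_{\mathbb{R}[X_{\mathcal{S}\times R_r}]}.$$ -/

import Mathlib

open scoped BigOperators

namespace DiscreteModel

/-- The joint state space `𝒮 × R = ([s₁] × ⋯ × [sₘ]) × ([r₁] × ⋯ × [rₙ])` of the random vector
`(Y, Z) = (Y₁, …, Yₘ, Z₁, …, Zₙ)`. -/
abbrev Cell {m n : ℕ} (s : Fin m → ℕ+) (r : Fin n → ℕ+) : Type :=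
  ((i : Fin m) → Fin (s i : ℕ)) × ((j : Fin n) → Fin (r j : ℕ))

/-- The homogeneous vanishing ideal of a set `M` of points: the ideal generated by all
homogeneous polynomials that vanish at every point of `M`. -/
noncomputable def homogeneousVanishingIdeal {ι : Type} (M : Set (ι → ℝ)) : Ideal (MvPolynomial ι ℝ) :=
  Ideal.span {f | (∃ d : ℕ, f.IsHomogeneous d) ∧ ∀ p ∈ M, MvPolynomial.eval p f = 0}

/-- The action of `σ ∈ 𝔖_{r₁} × ⋯ × 𝔖_{rₙ}` on states: `σ (y, z) = (y, (σ₁ z₁, …, σₙ zₙ))`. -/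
def permCell {m n : ℕ} (s : Fin m → ℕ+) {r : Fin n → ℕ+}
    (σ : (j : Fin n) → Equiv.Perm (Fin (r j : ℕ))) (c : Cell s r) : Cell s r :=
  (c.1, fun j => σ j (c.2 j))

/-- The action of `σ ∈ 𝔖_{r₁} × ⋯ × 𝔖_{rₙ}` on polynomials, given by `σ · x_c = x_{σ c}`. -/
noncomputable def permPoly {m n : ℕ} (s : Fin m → ℕ+) {r : Fin n → ℕ+}
    (σ : (j : Fin n) → Equiv.Perm (Fin (r j : ℕ))) :
    MvPolynomial (Cell s r) ℝ →ₐ[ℝ] MvPolynomial (Cell s r) ℝ :=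
  MvPolynomial.rename (permCell s σ)

/-- The inclusion of state spaces coming from `[r_j] ⊆ [r'_j]` for `r ≤ r'` componentwise. -/
def inclCell {m n : ℕ} (s : Fin m → ℕ+) {r r' : Fin n → ℕ+} (h : r ≤ r') (c : Cell s r) :
    Cell s r' :=
  (c.1, fun j => Fin.castLE (h j) (c.2 j))

/-- The inclusion `ℝ[X_{𝒮 × R}] ⊆ ℝ[X_{𝒮 × R'}]` for `r ≤ r'` componentwise. -/
noncomputable def inclPoly {m n : ℕ} (s : Fin m → ℕ+) {r r' : Fin n → ℕ+} (h : r ≤ r') :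
    MvPolynomial (Cell s r) ℝ →ₐ[ℝ] MvPolynomial (Cell s r') ℝ :=
  MvPolynomial.rename (inclCell s h)

/-- The ideal `I` is stable under the action of `𝔖_{r₁} × ⋯ × 𝔖_{rₙ}`. -/
def SymmetricIdeal {m n : ℕ} (s : Fin m → ℕ+) (r : Fin n → ℕ+)
    (I : Ideal (MvPolynomial (Cell s r) ℝ)) : Prop :=
  ∀ σ : (j : Fin n) → Equiv.Perm (Fin (r j : ℕ)), ∀ f ∈ I, permPoly s σ f ∈ I

/-- The ideals `I r` are nested: `I r ⊆ I r'` whenever `r ≤ r'` componentwise. -/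
def Nested {m n : ℕ} (s : Fin m → ℕ+)
    (I : (r : Fin n → ℕ+) → Ideal (MvPolynomial (Cell s r) ℝ)) : Prop :=
  ∀ (r r' : Fin n → ℕ+) (h : r ≤ r'), ∀ f ∈ I r, inclPoly s h f ∈ I r'

/-- `P(Y = y)` -/
noncomputable def probY {m n : ℕ} {s : Fin m → ℕ+} {r : Fin n → ℕ+} (p : Cell s r → ℝ)
    (y : (i : Fin m) → Fin (s i : ℕ)) : ℝ :=
  ∑ z : (j : Fin n) → Fin (r j : ℕ), p (y, z)

/-- `P(Y = y, Z_j = k)` -/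
noncomputable def probYZ {m n : ℕ} {s : Fin m → ℕ+} {r : Fin n → ℕ+} (p : Cell s r → ℝ)
    (y : (i : Fin m) → Fin (s i : ℕ)) (j : Fin n) (k : Fin (r j : ℕ)) : ℝ :=
  ∑ z : (j : Fin n) → Fin (r j : ℕ), if z j = k then p (y, z) else 0

/-- The conditional independence constraint `Z₁ ⫫ Z₂ ⫫ ⋯ ⫫ Zₙ | Y` for the distribution `p` of
`(Y, Z)`: `P(Z = z | Y = y) = ∏ⱼ P(Zⱼ = zⱼ | Y = y)` for all `z` and all `y` with
`P(Y = y) ≠ 0`. -/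
def CondIndep {m n : ℕ} {s : Fin m → ℕ+} {r : Fin n → ℕ+} (p : Cell s r → ℝ) : Prop :=
  ∀ y : (i : Fin m) → Fin (s i : ℕ), probY p y ≠ 0 →
    ∀ z : (j : Fin n) → Fin (r j : ℕ),
      p (y, z) / probY p y = ∏ j : Fin n, probYZ p y j (z j) / probY p y

/-- The ideals `I r` have a finite symmetric generating set as `r₁, …, rₙ → ∞`: there are `r₀` and
a finite set `F` of polynomials at level `r₀` such that for all `r ≥ r₀` the ideal `I r` is
generated by the `𝔖_{r₁} × ⋯ × 𝔖_{rₙ}`-orbits of the elements of `F`.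
(The case `r = r₀` gives `F ⊆ I r₀`.) -/
def HasFiniteSymmetricGeneratingSet {m n : ℕ} (s : Fin m → ℕ+)
    (I : (r : Fin n → ℕ+) → Ideal (MvPolynomial (Cell s r) ℝ)) : Prop :=
  ∃ (r₀ : Fin n → ℕ+) (F : Finset (MvPolynomial (Cell s r₀) ℝ)),
    ∀ (r : Fin n → ℕ+) (h : r₀ ≤ r),
      I r = Ideal.span {g | ∃ σ : (j : Fin n) → Equiv.Perm (Fin (r j : ℕ)), ∃ f ∈ F,
        g = permPoly s σ (inclPoly s h f)}

end DiscreteModel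

namespace DiscreteModel

open MvPolynomial

/-! Conditional independence puts every swap binomial, a quadric exchanging one coordinate between
two cells with the same `y`, into each `I r`. These binomials generate the kernel of the monomial
map `parametrization`, so modulo them a polynomial is determined by its image in the parameter ring,
where lex leading exponents are available.

Two facts make a Gröbner-type argument work there. If one monomial of the image algebra divides
another, the cofactor is again in that algebra (`exists_add_of_exponentMap_le`), so a leading term
can be cancelled without leaving the image. And exponent vectors of all levels together are
well-quasi-ordered under divisibility up to strictly increasing relabelling of each `[r_j]`
(`wellQuasiOrdered_exponents`, from Higman's lemma).

Hence finitely many polynomials have leading exponents that divide all others after relabelling.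
Increasing relabellings preserve lex order and extend to permutations, so the orbits of these
polynomials and of the swap binomials generate every `I r` beyond a suitable level. -/

/-- The parameters `u_y` and `v_{y,j,k}` of the conditional independence model, as a linearly
ordered set; `u_y` is the pair `(y, ⊥)`. -/
abbrev Param {m n : ℕ} (s : Fin m → ℕ+) (r : Fin n → ℕ+) : Type :=
  Lex ((i : Fin m) → Fin (s i : ℕ)) ×ₗ WithBot (Σₗ j : Fin n, Fin (r j : ℕ))

/-! ### Parameters and their relabelling -/

section Parameters

variable {m n : ℕ} {s : Fin m → ℕ+} {r r' : Fin n → ℕ+}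

/-- The parameter `u_y`, standing for `P(Y = y)`. -/
def uParam (r : Fin n → ℕ+) (y : (i : Fin m) → Fin (s i : ℕ)) : Param s r :=
  toLex (toLex y, ⊥)

/-- The parameter `v_{y,j,k}`, standing for `P(Z_j = k | Y = y)`. -/
def vParam (y : (i : Fin m) → Fin (s i : ℕ)) (j : Fin n) (k : Fin (r j : ℕ)) : Param s r :=
  toLex (toLex y, ((toLex ⟨j, k⟩ : Σₗ j : Fin n, Fin (r j : ℕ)) : WithBot _))

theorem Param.forall {p : Param s r → Prop} (hu : ∀ y, p (uParam r y))
    (hv : ∀ y j k, p (vParam y j k)) (v : Param s r) : p v := by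
  obtain ⟨y, q⟩ := v
  cases q with
  | bot => exact hu y
  | coe q => exact hv y q.1 q.2

instance : Finite (Param s r) :=
  inferInstanceAs (Finite (((i : Fin m) → Fin (s i : ℕ)) × Option (Σ j : Fin n, Fin (r j : ℕ))))

theorem uParam_inj {y y' : (i : Fin m) → Fin (s i : ℕ)} :
    uParam r y = uParam r y' ↔ y = y' := by
  constructor
  · intro h
    exact congrArg (fun v : Param s r => ofLex (ofLex v).1) h
  · rintro rfl; rfl

theorem vParam_inj {y y' : (i : Fin m) → Fin (s i : ℕ)} {j j' : Fin n} {k : Fin (r j : ℕ)}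
    {k' : Fin (r j' : ℕ)} :
    (vParam y j k : Param s r) = vParam y' j' k' ↔
      y = y' ∧ (⟨j, k⟩ : Σ j, Fin (r j : ℕ)) = ⟨j', k'⟩ := by
  constructor
  · intro h
    refine ⟨congrArg (fun v : Param s r => ofLex (ofLex v).1) h, ?_⟩
    have := congrArg (fun v : Param s r => (ofLex v).2) h
    exact WithBot.coe_injective this
  · rintro ⟨rfl, h⟩
    unfold vParam
    rw [h]

theorem uParam_ne_vParam {y y' : (i : Fin m) → Fin (s i : ℕ)} {j : Fin n} {k : Fin (r j : ℕ)} :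
    (uParam r y : Param s r) ≠ vParam y' j k := by
  intro h
  have := congrArg (fun v : Param s r => (ofLex v).2) h
  exact WithBot.bot_ne_coe this

/-- The map on cells induced by maps `[r_j] → [r'_j]`. -/
def mapCell (ε : ∀ j, Fin (r j : ℕ) → Fin (r' j : ℕ)) (c : Cell s r) : Cell s r' :=
  (c.1, fun j => ε j (c.2 j))

/-- The map on parameters induced by maps `[r_j] → [r'_j]`. -/
def mapParam (ε : ∀ j, Fin (r j : ℕ) → Fin (r' j : ℕ)) (v : Param s r) : Param s r' :=
  toLex ((ofLex v).1, (ofLex v).2.map fun q => toLex ⟨(ofLex q).1, ε _ (ofLex q).2⟩)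

@[simp]
theorem mapParam_uParam (ε : ∀ j, Fin (r j : ℕ) → Fin (r' j : ℕ))
    (y : (i : Fin m) → Fin (s i : ℕ)) : mapParam ε (uParam r y) = uParam r' y := rfl

@[simp]
theorem mapParam_vParam (ε : ∀ j, Fin (r j : ℕ) → Fin (r' j : ℕ))
    (y : (i : Fin m) → Fin (s i : ℕ)) (j : Fin n) (k : Fin (r j : ℕ)) :
    mapParam ε (vParam y j k) = vParam y j (ε j k) := rfl

/-- Parameters are ordered by `y`, then `u_y` before all `v_{y,j,k}`, then `j`, then `k`. A
relabelling changes only `k`, the last key. -/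
theorem mapParam_strictMono {ε : ∀ j, Fin (r j : ℕ) → Fin (r' j : ℕ)}
    (hε : ∀ j, StrictMono (ε j)) : StrictMono (mapParam (s := s) ε) := by
  have hσ : StrictMono fun q : Σₗ j : Fin n, Fin (r j : ℕ) =>
      (toLex ⟨(ofLex q).1, ε _ (ofLex q).2⟩ : Σₗ j : Fin n, Fin (r' j : ℕ)) := by
    intro a b hab
    rcases hab with ⟨_, _, h⟩ | ⟨_, _, h⟩
    · exact Sigma.Lex.left _ _ h
    · exact Sigma.Lex.right _ _ (hε _ h)
  intro a b hab
  rcases Prod.Lex.lt_iff.1 hab with h | ⟨h₁, h₂⟩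
  · exact Prod.Lex.lt_iff.2 (Or.inl h)
  · exact Prod.Lex.lt_iff.2 (Or.inr ⟨h₁, hσ.withBot_map h₂⟩)

end Parameters

/-! ### Lexicographic leading exponents under relabelling -/

section Lex

/-- The first index of disagreement is carried to its image under `g`; outside the range of `g` both
vectors vanish. -/
theorem lex_mapDomain_lt {α β : Type*} [LinearOrder α] [LinearOrder β] {g : α → β}
    (hg : StrictMono g) {a b : α →₀ ℕ} (hab : toLex a < toLex b) :
    toLex (a.mapDomain g) < toLex (b.mapDomain g) := by
  obtain ⟨j, hj, hlt⟩ := Finsupp.Lex.lt_iff.1 hab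
  refine Finsupp.Lex.lt_iff.2 ⟨g j, fun d hd => ?_, ?_⟩
  · by_cases hr : d ∈ Set.range g
    · obtain ⟨d, rfl⟩ := hr
      have := hj d (hg.lt_iff_lt.1 hd)
      simpa [Finsupp.mapDomain_apply hg.injective] using this
    · simp [Finsupp.mapDomain_of_notMem_range _ _ hr]
  · simpa [Finsupp.mapDomain_apply hg.injective] using hlt

theorem degree_lex_rename {α β R : Type*} [LinearOrder α] [Finite α] [LinearOrder β] [Finite β]
    [CommSemiring R] {g : α → β} (hg : StrictMono g) (P : MvPolynomial α R) :
    (MonomialOrder.lex (σ := β)).degree (rename g P) =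
      ((MonomialOrder.lex (σ := α)).degree P).mapDomain g := by
  classical
  by_cases hP : P = 0
  · simp [hP]
  apply (MonomialOrder.lex (σ := β)).toSyn.injective
  apply le_antisymm
  · rw [MonomialOrder.degree_le_iff]
    intro b hb
    rw [support_rename_of_injective hg.injective, Finset.mem_image] at hb
    obtain ⟨a, ha, rfl⟩ := hb
    have h : toLex a ≤ toLex ((MonomialOrder.lex (σ := α)).degree P) :=
      MonomialOrder.lex_le_iff.1 (MonomialOrder.le_degree ha)
    refine MonomialOrder.lex_le_iff.2 ?_
    rcases h.lt_or_eq with h | h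
    · exact (lex_mapDomain_lt hg h).le
    · rw [toLex_inj.1 h]
  · apply MonomialOrder.le_degree
    rw [support_rename_of_injective hg.injective]
    exact Finset.mem_image_of_mem _ (MonomialOrder.degree_mem_support hP)

end Lex

/-! ### Well-quasi-ordering of exponent vectors -/

section WellQuasiOrder

variable {m n : ℕ} {s : Fin m → ℕ+}

/-- The values of an exponent vector `a` at the parameters `v_{·,j,k}`, as a word in `k`. -/
def exponentWord {r : Fin n → ℕ+} (a : Param s r →₀ ℕ) (j : Fin n) :
    List (((i : Fin m) → Fin (s i : ℕ)) → ℕ) :=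
  List.ofFn fun k : Fin (r j : ℕ) => fun y => a (vParam y j k)

theorem exists_strictMono_of_sublistForall₂ {α : Type*} {R : α → α → Prop} {k l : ℕ}
    {f : Fin k → α} {g : Fin l → α} (h : List.SublistForall₂ R (List.ofFn f) (List.ofFn g)) :
    ∃ ε : Fin k → Fin l, StrictMono ε ∧ ∀ i, R (f i) (g (ε i)) := by
  obtain ⟨w, hw, hsub⟩ := List.sublistForall₂_iff.1 h
  obtain ⟨e, he⟩ := List.sublist_iff_exists_fin_orderEmbedding_get_eq.1 hsub
  obtain ⟨hlen, hR⟩ := List.forall₂_iff_get.1 hw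
  rw [List.length_ofFn] at hlen
  have hl : (List.ofFn g).length = l := List.length_ofFn
  refine ⟨fun i => Fin.cast hl (e (Fin.cast hlen i)), fun a b hab => ?_, fun i => ?_⟩
  · have : e (Fin.cast hlen a) < e (Fin.cast hlen b) := e.strictMono (by simpa using hab)
    simpa using this
  · have h₁ := hR i (by simp) (by rw [← hlen]; exact i.2)
    have h₂ := he (Fin.cast hlen i)
    simp only [List.get_eq_getElem, List.getElem_ofFn] at h₁ h₂
    simp only [Fin.val_cast] at h₂
    rw [h₂] at h₁
    exact h₁

/-- **Higman's lemma** for exponent vectors of varying levels. -/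
theorem wellQuasiOrdered_exponents :
    WellQuasiOrdered fun p q : Σ r : Fin n → ℕ+, Param s r →₀ ℕ =>
      ∃ ε : ∀ j, Fin (p.1 j : ℕ) → Fin (q.1 j : ℕ), (∀ j, StrictMono (ε j)) ∧
        p.2.mapDomain (mapParam ε) ≤ q.2 := by
  classical
  have hY : WellQuasiOrdered
      ((· ≤ ·) : (((i : Fin m) → Fin (s i : ℕ)) → ℕ) → _ → Prop) := wellQuasiOrdered_le
  have hW : WellQuasiOrdered (List.SublistForall₂
      ((· ≤ ·) : (((i : Fin m) → Fin (s i : ℕ)) → ℕ) → _ → Prop)) := by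
    rw [← Set.partiallyWellOrderedOn_univ_iff] at hY ⊢
    simpa using Set.PartiallyWellOrderedOn.partiallyWellOrderedOn_sublistForall₂ _ hY
  have : IsPreorder _ (List.SublistForall₂
      ((· ≤ ·) : (((i : Fin m) → Fin (s i : ℕ)) → ℕ) → _ → Prop)) := { }
  have hpi := WellQuasiOrdered.pi (ι := Fin n) (fun _ => hW)
  -- Dickson's lemma for the exponents of the `u_y`, which no relabelling moves, times Higman's
  -- lemma for the `n` words of `v`-exponents.
  have hprod := hY.prod hpi
  intro p
  obtain ⟨i, k, hik, hu, hv⟩ := hprod fun i =>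
    (fun y => (p i).2 (uParam _ y), fun j => exponentWord (p i).2 j)
  refine ⟨i, k, hik, ?_⟩
  choose ε hε hle using fun j => exists_strictMono_of_sublistForall₂ (hv j)
  refine ⟨ε, hε, fun w => ?_⟩
  by_cases hr : w ∈ Set.range (mapParam (s := s) ε)
  · obtain ⟨v, rfl⟩ := hr
    rw [Finsupp.mapDomain_apply (mapParam_strictMono hε).injective]
    induction v using Param.forall with
    | hu y => exact hu y
    | hv y j l => exact hle j l y
  · simp [Finsupp.mapDomain_of_notMem_range _ _ hr]

/-- Otherwise, choosing repeatedly an element of `T` above none of the earlier ones gives a bad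
sequence. -/
theorem exists_finite_basis_of_wellQuasiOrdered {α : Type*} {R : α → α → Prop}
    (hR : WellQuasiOrdered R) (T : Set α) :
    ∃ B : Finset α, (∀ b ∈ B, b ∈ T) ∧ ∀ t ∈ T, ∃ b ∈ B, R b t := by
  classical
  by_contra! h
  obtain ⟨f, -, hf⟩ := exists_seq_of_forall_finset_exists (· ∈ T) (fun x y => ¬ R x y) h
  obtain ⟨i, j, hij, hr⟩ := hR f
  exact hf i j hij hr

end WellQuasiOrder

/-! ### The monomial parametrization and its kernel -/

section Parametrization

variable {m n : ℕ} {s : Fin m → ℕ+} {r r' : Fin n → ℕ+}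

/-- The exponent vector of the monomial `u_y ∏ⱼ v_{y,j,z_j}`. -/
noncomputable def cellExponent (c : Cell s r) : Param s r →₀ ℕ :=
  Finsupp.single (uParam r c.1) 1 + ∑ j, Finsupp.single (vParam c.1 j (c.2 j)) 1

/-- The linear map on exponent vectors underlying `parametrization`. -/
noncomputable def exponentMap : (Cell s r →₀ ℕ) →ₗ[ℕ] (Param s r →₀ ℕ) :=
  Finsupp.linearCombination ℕ cellExponent

/-- The parametrization `x_{y,z} ↦ u_y ∏ⱼ v_{y,j,z_j}` of the conditional independence model. -/
noncomputable def parametrization : MvPolynomial (Cell s r) ℝ →ₐ[ℝ] MvPolynomial (Param s r) ℝ :=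
  aeval fun c => monomial (cellExponent c) 1

@[simp]
theorem exponentMap_single (c : Cell s r) (k : ℕ) :
    exponentMap (Finsupp.single c k) = k • cellExponent c := by
  simp [exponentMap, Finsupp.linearCombination_single]

theorem parametrization_monomial (a : Cell s r →₀ ℕ) (t : ℝ) :
    parametrization (monomial a t) = monomial (exponentMap a) t := by
  rw [parametrization, aeval_monomial, exponentMap, Finsupp.linearCombination_apply,
    Finsupp.sum, monomial_sum_index, Finsupp.prod]
  simp [monomial_pow, MvPolynomial.algebraMap_eq]

theorem cellExponent_uParam_ne_zero {c : Cell s r} {y : (i : Fin m) → Fin (s i : ℕ)} :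
    cellExponent c (uParam r y) ≠ 0 ↔ c.1 = y := by
  classical
  simp [cellExponent, Finsupp.single_apply, uParam_inj, uParam_ne_vParam.symm]

theorem cellExponent_vParam_ne_zero {c : Cell s r} {y : (i : Fin m) → Fin (s i : ℕ)} {j : Fin n}
    {k : Fin (r j : ℕ)} :
    cellExponent c (vParam y j k) ≠ 0 ↔ c.1 = y ∧ c.2 j = k := by
  classical
  simp only [cellExponent, Finsupp.add_apply, Finsupp.finsetSum_apply, Finsupp.single_apply,
    uParam_ne_vParam, if_false, zero_add, Finset.sum_eq_zero_iff, ne_eq, vParam_inj]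
  push Not
  constructor
  · rintro ⟨i, -, h⟩
    obtain ⟨h₁, h₂⟩ : c.1 = y ∧ (⟨i, c.2 i⟩ : Σ j, Fin (r j : ℕ)) = ⟨j, k⟩ := by
      by_contra h'
      exact h' (by simpa using h)
    obtain rfl : i = j := congrArg Sigma.fst h₂
    exact ⟨h₁, eq_of_heq (Sigma.mk.inj h₂).2⟩
  · rintro ⟨rfl, rfl⟩
    exact ⟨j, Finset.mem_univ _, by simp⟩

theorem exists_mem_of_exponentMap_ne_zero {a : Cell s r →₀ ℕ} {v : Param s r}
    (h : exponentMap a v ≠ 0) :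
    ∃ c b, a = Finsupp.single c 1 + b ∧ cellExponent c v ≠ 0 := by
  rw [exponentMap, Finsupp.linearCombination_apply, Finsupp.sum, Finsupp.finsetSum_apply] at h
  obtain ⟨c, hc, hne⟩ := Finset.exists_ne_zero_of_sum_ne_zero h
  refine ⟨c, a - Finsupp.single c 1, ?_, fun h0 => hne (by simp [h0])⟩
  rw [add_tsub_cancel_of_le]
  simpa [Nat.one_le_iff_ne_zero] using hc

/-- Every cell contributes its factor `u_y`, so no nontrivial monomial maps to 1. -/
theorem exponentMap_eq_zero_iff {a : Cell s r →₀ ℕ} : exponentMap a = 0 ↔ a = 0 := by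
  refine ⟨fun h => ?_, fun h => by simp [h]⟩
  by_contra hne
  obtain ⟨c, hc⟩ := Finsupp.support_nonempty_iff.2 hne
  have : cellExponent c (uParam r c.1) ≤ exponentMap a (uParam r c.1) := by
    have hle : Finsupp.single c 1 ≤ a := by
      simpa [Nat.one_le_iff_ne_zero] using hc
    rw [← add_tsub_cancel_of_le hle, map_add]
    simp
  rw [h] at this
  exact cellExponent_uParam_ne_zero.2 rfl (Nat.le_zero.1 this)

theorem exponentMap_mapDomain (ε : ∀ j, Fin (r j : ℕ) → Fin (r' j : ℕ)) (a : Cell s r →₀ ℕ) :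
    exponentMap (a.mapDomain (mapCell ε)) = (exponentMap a).mapDomain (mapParam ε) := by
  induction a using Finsupp.induction_linear with
  | zero => simp
  | add a b ha hb => simp [Finsupp.mapDomain_add, ha, hb]
  | single c k =>
    rw [Finsupp.mapDomain_single, exponentMap_single, exponentMap_single,
      Finsupp.mapDomain_smul, cellExponent, cellExponent, Finsupp.mapDomain_add,
      Finsupp.mapDomain_finsetSum]
    simp [Finsupp.mapDomain_single, mapCell]

theorem parametrization_rename (ε : ∀ j, Fin (r j : ℕ) → Fin (r' j : ℕ))
    (f : MvPolynomial (Cell s r) ℝ) :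
    parametrization (rename (mapCell ε) f) = rename (mapParam ε) (parametrization f) := by
  induction f using MvPolynomial.induction_on' with
  | monomial a t =>
    rw [rename_monomial, parametrization_monomial, parametrization_monomial, rename_monomial,
      exponentMap_mapDomain]
  | add p q hp hq => simp [hp, hq]

/-- The quadratic binomial that exchanges the `j`-th coordinates of two cells `(y, z)`, `(y, z')`. -/
noncomputable def swapBinomial (y : (i : Fin m) → Fin (s i : ℕ)) (z z' : (j : Fin n) → Fin (r j : ℕ))
    (j : Fin n) : MvPolynomial (Cell s r) ℝ :=
  X (y, z) * X (y, z') - X (y, Function.update z j (z' j)) * X (y, Function.update z' j (z j))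

theorem cellExponent_swap (y : (i : Fin m) → Fin (s i : ℕ)) (z z' : (j : Fin n) → Fin (r j : ℕ))
    (j : Fin n) :
    (cellExponent (y, z) + cellExponent (y, z') : Param s r →₀ ℕ) =
      cellExponent (y, Function.update z j (z' j)) +
        cellExponent (y, Function.update z' j (z j)) := by
  simp only [cellExponent]
  refine (add_add_add_comm _ _ _ _).trans (Eq.trans ?_ (add_add_add_comm _ _ _ _))
  rw [← Finset.sum_add_distrib, ← Finset.sum_add_distrib]
  congr 1
  refine Finset.sum_congr rfl fun i _ => ?_
  by_cases h : i = j
  · subst h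
    simp [add_comm]
  · simp [h]

theorem monomial_swap_sub_mem {K : Ideal (MvPolynomial (Cell s r) ℝ)}
    {y : (i : Fin m) → Fin (s i : ℕ)} {z z' : (j : Fin n) → Fin (r j : ℕ)} {j : Fin n}
    (h : swapBinomial y z z' j ∈ K) (b : Cell s r →₀ ℕ) :
    (monomial (Finsupp.single (y, z) 1 + (Finsupp.single (y, z') 1 + b)) 1 -
      monomial (Finsupp.single (y, Function.update z j (z' j)) 1 +
        (Finsupp.single (y, Function.update z' j (z j)) 1 + b)) 1 :
          MvPolynomial (Cell s r) ℝ) ∈ K := by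
  have h₁ (c c' : Cell s r) : (monomial (Finsupp.single c 1 + (Finsupp.single c' 1 + b)) 1 :
      MvPolynomial (Cell s r) ℝ) = monomial b 1 * (X c * X c') := by
    rw [X, X, monomial_mul, monomial_mul]
    simp [add_comm, add_left_comm]
  rw [h₁, h₁, ← mul_sub]
  exact K.mul_mem_left _ h

/-- Modulo the swap binomials, a monomial whose image is divisible by that of `x_{y,z}` can be
rewritten as a multiple of `x_{y,z}`. -/
theorem exists_single_add_of_cellExponent_le {K : Ideal (MvPolynomial (Cell s r) ℝ)}
    (hK : ∀ y z z' j, swapBinomial y z z' j ∈ K) {c : Cell s r} {a : Cell s r →₀ ℕ}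
    (h : cellExponent c ≤ exponentMap a) :
    ∃ b, exponentMap a = exponentMap (Finsupp.single c 1 + b) ∧
      (monomial a 1 - monomial (Finsupp.single c 1 + b) 1 : MvPolynomial (Cell s r) ℝ) ∈ K := by
  obtain ⟨y, z⟩ := c
  have key (T : Finset (Fin n)) : ∃ w b, (∀ j ∈ T, w j = z j) ∧
      exponentMap a = exponentMap (Finsupp.single (y, w) 1 + b) ∧
      (monomial a 1 - monomial (Finsupp.single (y, w) 1 + b) 1 :
        MvPolynomial (Cell s r) ℝ) ∈ K := by
    induction T using Finset.induction_on with
    | empty =>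
      -- The factor `u_y` can only come from a cell `(y, w)`; its coordinates are then corrected one
      -- at a time.
      have hu : exponentMap a (uParam r y) ≠ 0 := fun h0 =>
        cellExponent_uParam_ne_zero.2 rfl (Nat.le_zero.1 ((h (uParam r y)).trans h0.le))
      obtain ⟨⟨y', w⟩, b, rfl, hc⟩ := exists_mem_of_exponentMap_ne_zero hu
      obtain rfl : y' = y := cellExponent_uParam_ne_zero.1 hc
      exact ⟨w, b, by simp, rfl, by simp⟩
    | insert j T hj ih =>
      obtain ⟨w, b, hw, he, hm⟩ := ih
      by_cases hwj : w j = z j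
      · exact ⟨w, b, by simpa [hwj] using hw, he, hm⟩
      -- As `w j ≠ z j`, the factor `v_{y,j,z_j}` comes from another cell `(y, w')` with `w' j = z
      -- j`; swapping the `j`-th coordinates corrects `w`.
      have hv : exponentMap b (vParam y j (z j)) ≠ 0 := by
        intro h0
        have h₁ := h (vParam y j (z j))
        have h₂ : cellExponent (y, w) (vParam y j (z j)) = 0 := by
          by_contra h'
          exact hwj (cellExponent_vParam_ne_zero.1 h').2
        rw [he, map_add, exponentMap_single, one_smul, Finsupp.add_apply, h0, h₂] at h₁
        exact cellExponent_vParam_ne_zero.2 ⟨rfl, rfl⟩ (Nat.le_zero.1 h₁)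
      obtain ⟨⟨y', w'⟩, b, rfl, hc⟩ := exists_mem_of_exponentMap_ne_zero hv
      obtain ⟨rfl, hw'⟩ : y' = y ∧ w' j = z j := cellExponent_vParam_ne_zero.1 hc
      refine ⟨Function.update w j (w' j),
        Finsupp.single (y', Function.update w' j (w j)) 1 + b, ?_, ?_, ?_⟩
      · intro i hi
        by_cases hij : i = j
        · subst hij; simpa using hw'
        · simpa [hij] using hw i (Finset.mem_of_mem_insert_of_ne hi hij)
      · rw [he]
        simp only [map_add, exponentMap_single, one_smul, ← add_assoc]
        rw [cellExponent_swap]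
      · have := K.add_mem hm (monomial_swap_sub_mem (hK y' w w' j) b)
        simpa using this
  obtain ⟨w, b, hw, he, hm⟩ := key Finset.univ
  obtain rfl : w = z := funext fun j => hw j (Finset.mem_univ j)
  exact ⟨b, he, hm⟩

/-- Split off the variables of `a₀` one by one, cancelling each from both sides. -/
theorem exists_add_of_exponentMap_le {K : Ideal (MvPolynomial (Cell s r) ℝ)}
    (hK : ∀ y z z' j, swapBinomial y z z' j ∈ K) {a₀ a : Cell s r →₀ ℕ}
    (h : exponentMap a₀ ≤ exponentMap a) :
    ∃ b, exponentMap a = exponentMap (a₀ + b) ∧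
      (monomial a 1 - monomial (a₀ + b) 1 : MvPolynomial (Cell s r) ℝ) ∈ K := by
  suffices H : ∀ d (a₀ a : Cell s r →₀ ℕ), a₀.degree = d → exponentMap a₀ ≤ exponentMap a →
      ∃ b, exponentMap a = exponentMap (a₀ + b) ∧
        (monomial a 1 - monomial (a₀ + b) 1 : MvPolynomial (Cell s r) ℝ) ∈ K from H _ a₀ a rfl h
  intro d
  induction d with
  | zero =>
    intro a₀ a hd _
    obtain rfl : a₀ = 0 := (Finsupp.degree_eq_zero_iff _).1 hd
    exact ⟨a, by simp, by simp⟩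
  | succ d ih =>
    intro a₀ a hd h
    have hne : a₀ ≠ 0 := by rintro rfl; simp at hd
    obtain ⟨c, hc⟩ := Finsupp.support_nonempty_iff.2 hne
    obtain ⟨a₁, rfl⟩ : ∃ a₁, a₀ = Finsupp.single c 1 + a₁ := by
      refine ⟨a₀ - Finsupp.single c 1, (add_tsub_cancel_of_le ?_).symm⟩
      simpa [Nat.one_le_iff_ne_zero] using hc
    have hd₁ : a₁.degree = d := by
      rw [map_add, Finsupp.degree_single] at hd
      omega
    rw [map_add, exponentMap_single, one_smul] at h
    obtain ⟨a₂, he₂, hm₂⟩ := exists_single_add_of_cellExponent_le hK (le_self_add.trans h)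
    rw [he₂, map_add, exponentMap_single, one_smul, add_le_add_iff_left] at h
    obtain ⟨b, he, hm⟩ := ih a₁ a₂ hd₁ h
    refine ⟨b, ?_, ?_⟩
    · rw [he₂, map_add, he, add_assoc, map_add _ (Finsupp.single c 1)]
    · have := K.add_mem hm₂ (K.mul_mem_left (monomial (Finsupp.single c 1) 1) hm)
      rw [mul_sub, monomial_mul, monomial_mul, one_mul] at this
      simpa [add_assoc] using this

/-- The cofactor given by `exists_add_of_exponentMap_le` has trivial image, hence is trivial. -/
theorem monomial_sub_mem_of_exponentMap_eq {K : Ideal (MvPolynomial (Cell s r) ℝ)}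
    (hK : ∀ y z z' j, swapBinomial y z z' j ∈ K) {a b : Cell s r →₀ ℕ}
    (h : exponentMap a = exponentMap b) :
    (monomial a 1 - monomial b 1 : MvPolynomial (Cell s r) ℝ) ∈ K := by
  obtain ⟨t, he, hm⟩ := exists_add_of_exponentMap_le hK h.ge
  rw [h, map_add] at he
  have ht : exponentMap t = 0 := by simpa using he.symm
  rw [exponentMap_eq_zero_iff.1 ht, add_zero] at hm
  exact hm

theorem mem_of_parametrization_eq_zero {K : Ideal (MvPolynomial (Cell s r) ℝ)}
    (hK : ∀ y z z' j, swapBinomial y z z' j ∈ K) {f : MvPolynomial (Cell s r) ℝ}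
    (hf : parametrization f = 0) : f ∈ K := by
  -- `Λ` sends each image monomial to a chosen monomial preimage; modulo `K` it inverts
  -- `parametrization`.
  let Λ : MvPolynomial (Param s r) ℝ →ₗ[ℝ] MvPolynomial (Cell s r) ℝ :=
    (basisMonomials (Param s r) ℝ).constr ℝ fun a =>
      monomial (Function.invFun (exponentMap (s := s) (r := r)) a) 1
  have hΛ (a : Param s r →₀ ℕ) (t : ℝ) :
      Λ (monomial a t) = t • monomial (Function.invFun (exponentMap (s := s) (r := r)) a) 1 := by
    have h₁ : (monomial a t : MvPolynomial (Param s r) ℝ) =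
        t • basisMonomials (Param s r) ℝ a := by
      simp [smul_monomial]
    rw [h₁, map_smul, Module.Basis.constr_basis]
  have key (g : MvPolynomial (Cell s r) ℝ) : g - Λ (parametrization g) ∈ K := by
    induction g using MvPolynomial.induction_on' with
    | monomial a t =>
      have ha : exponentMap (Function.invFun (exponentMap (s := s) (r := r)) (exponentMap a)) =
          exponentMap a := Function.invFun_eq ⟨a, rfl⟩
      have := K.mul_mem_left (C t) (monomial_sub_mem_of_exponentMap_eq hK ha.symm)
      rw [parametrization_monomial, hΛ]
      simpa [mul_sub, C_mul_monomial, smul_monomial] using this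
    | add p q hp hq =>
      have := K.add_mem hp hq
      rw [map_add, map_add]
      convert this using 1
      ring
  simpa [hf] using key f

theorem exists_exponentMap_eq_of_mem_support {f : MvPolynomial (Cell s r) ℝ}
    {d : Param s r →₀ ℕ} (hd : d ∈ (parametrization f).support) : ∃ a, exponentMap a = d := by
  classical
  induction f using MvPolynomial.induction_on' with
  | monomial a t =>
    rw [parametrization_monomial] at hd
    exact ⟨a, (Finset.mem_singleton.1 (support_monomial_subset hd)).symm⟩
  | add p q hp hq =>
    rw [map_add] at hd
    rcases Finset.mem_union.1 (support_add hd) with h | h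
    · exact hp h
    · exact hq h

end Parametrization

/-! ### From injections to permutations -/

section Permutations

theorem exists_perm_castLE {k l : ℕ} (h : k ≤ l) {ε : Fin k → Fin l}
    (hε : Function.Injective ε) : ∃ σ : Equiv.Perm (Fin l), ∀ i, σ (Fin.castLE h i) = ε i := by
  classical
  let e : {x // x ∈ Set.range (Fin.castLE h)} ≃ {x // x ∈ Set.range ε} :=
    (Equiv.ofInjective _ (Fin.castLE_injective h)).symm.trans (Equiv.ofInjective ε hε)
  refine ⟨e.extendSubtype, fun i => ?_⟩
  rw [Equiv.extendSubtype_apply_of_mem e _ ⟨i, rfl⟩]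
  simp [e, Equiv.ofInjective_symm_apply]

/-- A swap binomial involves at most two values of each coordinate, so level 2 already represents
all orbits. -/
theorem exists_perm_castLE_pair {k l : ℕ} (h : k ≤ l) (hk : 2 ≤ k) (a b : Fin l) :
    ∃ (σ : Equiv.Perm (Fin l)) (a' b' : Fin k),
      σ (Fin.castLE h a') = a ∧ σ (Fin.castLE h b') = b := by
  by_cases hab : a = b
  · subst hab
    exact ⟨Equiv.swap (Fin.castLE h ⟨0, by omega⟩) a, ⟨0, by omega⟩, ⟨0, by omega⟩, by simp⟩
  · obtain ⟨σ, hσ⟩ := exists_perm_castLE (hk.trans h) (ε := ![a, b]) (by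
      intro i j hij
      fin_cases i <;> fin_cases j <;> simp_all [eq_comm])
    exact ⟨σ, Fin.castLE hk 0, Fin.castLE hk 1, by simpa using hσ 0, by simpa using hσ 1⟩

variable {m n : ℕ} {s : Fin m → ℕ+} {r r' : Fin n → ℕ+}

theorem exists_permPoly_inclPoly_eq_rename (h : r ≤ r')
    {ε : ∀ j, Fin (r j : ℕ) → Fin (r' j : ℕ)} (hε : ∀ j, Function.Injective (ε j)) :
    ∃ σ : (j : Fin n) → Equiv.Perm (Fin (r' j : ℕ)), ∀ f : MvPolynomial (Cell s r) ℝ,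
      permPoly s σ (inclPoly s h f) = rename (mapCell ε) f := by
  choose σ hσ using fun j => exists_perm_castLE (h j) (hε j)
  refine ⟨σ, fun f => ?_⟩
  change rename _ (rename _ f) = _
  rw [rename_rename]
  congr 2
  funext c
  exact Prod.ext rfl (funext fun j => hσ j (c.2 j))

theorem inclPoly_inclPoly {r'' : Fin n → ℕ+} (h : r ≤ r') (h' : r' ≤ r'')
    (f : MvPolynomial (Cell s r) ℝ) :
    inclPoly s h' (inclPoly s h f) = inclPoly s (h.trans h') f := by
  rw [inclPoly, inclPoly, rename_rename]
  rfl

theorem exists_permPoly_inclPoly_swapBinomial (h : r ≤ r') (hr : ∀ j, 2 ≤ (r j : ℕ))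
    (y : (i : Fin m) → Fin (s i : ℕ)) (z z' : (j : Fin n) → Fin (r' j : ℕ)) (j : Fin n) :
    ∃ (σ : (j : Fin n) → Equiv.Perm (Fin (r' j : ℕ))) (w w' : (j : Fin n) → Fin (r j : ℕ)),
      swapBinomial y z z' j = permPoly s σ (inclPoly s h (swapBinomial y w w' j)) := by
  have h' (i) : (r i : ℕ) ≤ (r' i : ℕ) := h i
  choose σ w w' hw hw' using fun i => exists_perm_castLE_pair (h' i) (hr i) (z i) (z' i)
  refine ⟨σ, w, w', ?_⟩
  have hX (x : (j : Fin n) → Fin (r j : ℕ)) : permPoly s σ (inclPoly s h (X (y, x))) =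
      X (y, fun i => σ i (Fin.castLE (h' i) (x i))) := by
    exact (congrArg (rename _) (rename_X _ _)).trans (rename_X _ _)
  have hupd (x : (j : Fin n) → Fin (r j : ℕ)) (t : Fin (r j : ℕ)) :
      (fun i => σ i (Fin.castLE (h' i) (Function.update x j t i))) =
        Function.update (fun i => σ i (Fin.castLE (h' i) (x i))) j (σ j (Fin.castLE (h' j) t)) := by
    funext i
    by_cases hij : i = j
    · subst hij; simp
    · simp [hij]
  simp only [swapBinomial, map_sub, map_mul, hX, hupd, hw, hw']

end Permutations

/-! ### Swap binomials vanish on the model -/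

section ConditionalIndependence

variable {m n : ℕ} {s : Fin m → ℕ+} {r : Fin n → ℕ+}

theorem swapBinomial_isHomogeneous (y : (i : Fin m) → Fin (s i : ℕ))
    (z z' : (j : Fin n) → Fin (r j : ℕ)) (j : Fin n) :
    (swapBinomial y z z' j).IsHomogeneous 2 :=
  ((isHomogeneous_X ℝ _).mul (isHomogeneous_X ℝ _)).sub
    ((isHomogeneous_X ℝ _).mul (isHomogeneous_X ℝ _))

theorem prod_mul_prod_update {n : ℕ} {κ : Fin n → Type*} (q : (j : Fin n) → κ j → ℝ)
    (z z' : (j : Fin n) → κ j) (j : Fin n) :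
    (∏ i, q i (z i)) * ∏ i, q i (z' i) =
      (∏ i, q i (Function.update z j (z' j) i)) * ∏ i, q i (Function.update z' j (z j) i) := by
  rw [← Finset.prod_mul_distrib, ← Finset.prod_mul_distrib]
  refine Finset.prod_congr rfl fun i _ => ?_
  by_cases h : i = j
  · subst h
    simp [mul_comm]
  · simp [h]

theorem eval_swapBinomial_eq_zero {p : Cell s r → ℝ} (hp : p ∈ stdSimplex ℝ (Cell s r))
    (hCI : CondIndep p) (y : (i : Fin m) → Fin (s i : ℕ)) (z z' : (j : Fin n) → Fin (r j : ℕ))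
    (j : Fin n) : eval p (swapBinomial y z z' j) = 0 := by
  simp only [swapBinomial, map_sub, map_mul, eval_X]
  -- If `P(Y = y) = 0`, nonnegativity forces every `p (y, z)` to vanish; otherwise `p (y, z)`
  -- factors over the coordinates.
  by_cases h0 : probY p y = 0
  · have h (z : (j : Fin n) → Fin (r j : ℕ)) : p (y, z) = 0 :=
      (Finset.sum_eq_zero_iff_of_nonneg fun z _ => hp.1 (y, z)).1 h0 z (Finset.mem_univ z)
    simp [h]
  · have h (z : (j : Fin n) → Fin (r j : ℕ)) :
        p (y, z) = probY p y * ∏ j, probYZ p y j (z j) / probY p y := by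
      rw [← hCI y h0 z, mul_div_cancel₀ _ h0]
    have hswap := prod_mul_prod_update (fun j k => probYZ p y j k / probY p y) z z' j
    rw [h z, h z', h, h (Function.update z' _ _), mul_mul_mul_comm, hswap,
      mul_mul_mul_comm (probY p y), sub_self]

theorem swapBinomial_mem_homogeneousVanishingIdeal {M : Set (Cell s r → ℝ)}
    (hM : M ⊆ stdSimplex ℝ (Cell s r)) (hCI : ∀ p ∈ M, CondIndep p)
    (y : (i : Fin m) → Fin (s i : ℕ)) (z z' : (j : Fin n) → Fin (r j : ℕ)) (j : Fin n) :
    swapBinomial y z z' j ∈ homogeneousVanishingIdeal M :=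
  Ideal.subset_span ⟨⟨2, swapBinomial_isHomogeneous y z z' j⟩,
    fun p hp => eval_swapBinomial_eq_zero (hM hp) (hCI p hp) y z z' j⟩

end ConditionalIndependence

/-! ### Division by leading exponents -/

section Reduction

variable {m n : ℕ} {s : Fin m → ℕ+} {r : Fin n → ℕ+}

/-- The leading exponent of the image of `f` in the parameter ring. -/
noncomputable def leadingExponent (f : MvPolynomial (Cell s r) ℝ) : Param s r →₀ ℕ :=
  (MonomialOrder.lex (σ := Param s r)).degree (parametrization f)

/-- One step of division: if the leading exponent of `g` divides that of `f`, then a multiple of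
`g` cancels the leading term of `f`. -/
theorem exists_sub_mul_leadingExponent_lt {f g : MvPolynomial (Cell s r) ℝ}
    (hf : parametrization f ≠ 0) (hg : parametrization g ≠ 0)
    (h : leadingExponent g ≤ leadingExponent f) :
    ∃ q, parametrization (f - q * g) = 0 ∨
      (MonomialOrder.lex (σ := Param s r)).toSyn (leadingExponent (f - q * g)) <
        (MonomialOrder.lex (σ := Param s r)).toSyn (leadingExponent f) := by
  let mo := MonomialOrder.lex (σ := Param s r)
  obtain ⟨a, ha⟩ := exists_exponentMap_eq_of_mem_support (mo.degree_mem_support hf)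
  obtain ⟨a₀, ha₀⟩ := exists_exponentMap_eq_of_mem_support (mo.degree_mem_support hg)
  have hle : exponentMap a₀ ≤ exponentMap a := by rw [ha, ha₀]; exact h
  -- Only the exponent identity is needed, so the ideal may be taken to be everything.
  obtain ⟨b, hb, -⟩ := exists_add_of_exponentMap_le (K := ⊤) (fun _ _ _ _ => Submodule.mem_top) hle
  let t := mo.leadingCoeff (parametrization f) / mo.leadingCoeff (parametrization g)
  have hlf : mo.leadingCoeff (parametrization f) ≠ 0 := mo.leadingCoeff_ne_zero_iff.2 hf
  have hlg : mo.leadingCoeff (parametrization g) ≠ 0 := mo.leadingCoeff_ne_zero_iff.2 hg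
  have ht : t ≠ 0 := div_ne_zero hlf hlg
  have hN₀ : (monomial (exponentMap b) t : MvPolynomial (Param s r) ℝ) ≠ 0 := by
    simpa using ht
  set N := monomial (exponentMap b) t * parametrization g with hN
  have hdeg : mo.degree N = mo.degree (parametrization f) := by
    rw [hN, mo.degree_mul hN₀ hg, mo.degree_monomial, if_neg ht, ← ha, ← ha₀, hb, map_add, add_comm]
  have hlead : mo.leadingCoeff N = mo.leadingCoeff (parametrization f) := by
    rw [hN, mo.leadingCoeff_mul, mo.leadingCoeff_monomial, div_mul_cancel₀ _ hlg]
  refine ⟨monomial b t, or_iff_not_imp_left.2 fun hne => ?_⟩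
  have hsub : parametrization (f - monomial b t * g) = parametrization f - N := by
    rw [map_sub, map_mul, parametrization_monomial]
  rw [leadingExponent, hsub]
  rw [hsub] at hne
  refine lt_of_le_of_ne ?_ fun heq => ?_
  · refine (MonomialOrder.degree_sub_le).trans ?_
    exact sup_le le_rfl (congrArg mo.toSyn hdeg).le
  -- Equal degrees are impossible: `N` has the leading term of the image of `f`, so that coefficient
  -- cancels.
  · have hd : mo.degree (parametrization f - N) = mo.degree (parametrization f) :=
      mo.toSyn.injective heq
    refine mo.coeff_degree_ne_zero_iff.2 hne ?_
    rw [hd, coeff_sub]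
    nth_rewrite 2 [← hdeg]
    exact sub_eq_zero.2 hlead.symm

/-- An ideal `K` containing the swap binomials contains every ideal `I ⊇ K` whose
leading exponents are all divisible by leading exponents of elements of `K`. -/
theorem le_of_leadingExponent_le {I K : Ideal (MvPolynomial (Cell s r) ℝ)} (hKI : K ≤ I)
    (hK : ∀ y z z' j, swapBinomial y z z' j ∈ K)
    (hlead : ∀ f ∈ I, parametrization f ≠ 0 →
      ∃ g ∈ K, parametrization g ≠ 0 ∧ leadingExponent g ≤ leadingExponent f) : I ≤ K := by
  suffices H : ∀ (d : (MonomialOrder.lex (σ := Param s r)).syn) (f : MvPolynomial (Cell s r) ℝ),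
      (MonomialOrder.lex (σ := Param s r)).toSyn (leadingExponent f) = d → f ∈ I → f ∈ K from
    fun f hf => H _ f rfl hf
  intro d
  induction d using WellFoundedLT.induction with
  | ind d ih =>
    rintro f rfl hf
    by_cases h0 : parametrization f = 0
    · exact mem_of_parametrization_eq_zero hK h0
    obtain ⟨g, hgK, hg, hle⟩ := hlead f hf h0
    obtain ⟨q, hq⟩ := exists_sub_mul_leadingExponent_lt h0 hg hle
    have hqg := K.mul_mem_left q hgK
    refine (K.sub_mem_iff_left hqg).1 ?_
    rcases hq with hq | hq
    · exact mem_of_parametrization_eq_zero hK hq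
    · exact ih _ hq _ rfl (I.sub_mem hf (hKI hqg))

end Reduction

/-- A nested family of symmetric ideals containing the swap binomials has a finite symmetric
generating set. -/
theorem hasFiniteSymmetricGeneratingSet_of_swapBinomial_mem {m n : ℕ} {s : Fin m → ℕ+}
    {I : (r : Fin n → ℕ+) → Ideal (MvPolynomial (Cell s r) ℝ)}
    (hsymm : ∀ r, SymmetricIdeal s r (I r)) (hnested : Nested s I)
    (hswap : ∀ r y z z' j, swapBinomial y z z' j ∈ I r) :
    HasFiniteSymmetricGeneratingSet s I := by
  classical
  obtain ⟨B, hBT, hB⟩ := exists_finite_basis_of_wellQuasiOrdered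
    (R := fun p q : Σ r : Fin n → ℕ+, MvPolynomial (Cell s r) ℝ =>
      ∃ ε : ∀ j, Fin (p.1 j : ℕ) → Fin (q.1 j : ℕ), (∀ j, StrictMono (ε j)) ∧
        (leadingExponent p.2).mapDomain (mapParam ε) ≤ leadingExponent q.2)
    (fun p => wellQuasiOrdered_exponents fun i => ⟨(p i).1, leadingExponent (p i).2⟩)
    {p | p.2 ∈ I p.1 ∧ parametrization p.2 ≠ 0}
  obtain ⟨r₁, hr₁⟩ := (B.image Sigma.fst).exists_le
  -- Above the levels of all basis elements, and at least 2 for the swap binomials.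
  let r₀ := r₁ ⊔ fun _ => 2
  have hB₀ (p) (hp : p ∈ B) : p.1 ≤ r₀ :=
    (hr₁ _ (Finset.mem_image_of_mem _ hp)).trans le_sup_left
  have h₂ (j) : 2 ≤ (r₀ j : ℕ) := (le_sup_right : (fun _ => 2) ≤ r₀) j
  -- The value 0 is never taken, by `hB₀`.
  let F₁ := B.image fun p => if h : p.1 ≤ r₀ then inclPoly s h p.2 else 0
  let F₂ := Finset.univ.image fun t : (((i : Fin m) → Fin (s i : ℕ)) ×
    ((j : Fin n) → Fin (r₀ j : ℕ)) × ((j : Fin n) → Fin (r₀ j : ℕ)) × Fin n) =>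
      swapBinomial t.1 t.2.1 t.2.2.1 t.2.2.2
  have hF (f) (hf : f ∈ F₁ ∪ F₂) : f ∈ I r₀ := by
    rcases Finset.mem_union.1 hf with hf | hf
    · obtain ⟨p, hp, rfl⟩ := Finset.mem_image.1 hf
      simp only [dif_pos (hB₀ p hp)]
      exact hnested _ _ _ _ (hBT p hp).1
    · obtain ⟨t, -, rfl⟩ := Finset.mem_image.1 hf
      exact hswap _ _ _ _ _
  refine ⟨r₀, F₁ ∪ F₂, fun r h => ?_⟩
  set G : Set (MvPolynomial (Cell s r) ℝ) :=
    {g | ∃ σ : (j : Fin n) → Equiv.Perm (Fin (r j : ℕ)), ∃ f ∈ F₁ ∪ F₂,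
      g = permPoly s σ (inclPoly s h f)}
  have hGI : Ideal.span G ≤ I r := by
    refine Ideal.span_le.2 ?_
    rintro _ ⟨σ, f, hf, rfl⟩
    exact hsymm r σ _ (hnested _ _ h _ (hF f hf))
  refine le_antisymm (le_of_leadingExponent_le hGI (fun y z z' j => ?_) fun f hf h0 => ?_) hGI
  · obtain ⟨σ, w, w', hw⟩ := exists_permPoly_inclPoly_swapBinomial h h₂ y z z' j
    exact Ideal.subset_span ⟨σ, _, Finset.mem_union_right _
      (Finset.mem_image.2 ⟨(y, w, w', j), Finset.mem_univ _, rfl⟩), hw⟩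
  · obtain ⟨⟨r₂, g⟩, hp, ε, hε, hle⟩ := hB ⟨r, f⟩ ⟨hf, h0⟩
    have hr₂ : r₂ ≤ r₀ := hB₀ _ hp
    obtain ⟨σ, hσ⟩ := exists_permPoly_inclPoly_eq_rename (s := s) (hr₂.trans h)
      fun j => (hε j).injective
    refine ⟨rename (mapCell ε) g, Ideal.subset_span ⟨σ, inclPoly s hr₂ g,
      Finset.mem_union_left _ (Finset.mem_image.2 ⟨_, hp, dif_pos hr₂⟩), ?_⟩, ?_, ?_⟩
    · rw [inclPoly_inclPoly, hσ]
    · rw [parametrization_rename]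
      have := (hBT _ hp).2
      rwa [ne_eq, map_eq_zero_iff _ (rename_injective _ (mapParam_strictMono hε).injective)]
    · rw [leadingExponent, parametrization_rename, degree_lex_rename (mapParam_strictMono hε)]
      exact hle

end DiscreteModel

theorem mainTheorem10 (m n : ℕ) (s : Fin m → ℕ+)
    (M : (r : Fin n → ℕ+) → Set (DiscreteModel.Cell s r → ℝ))
    (hM : ∀ r, M r ⊆ stdSimplex ℝ (DiscreteModel.Cell s r))
    (hsymm : ∀ r, DiscreteModel.SymmetricIdeal s r
      (DiscreteModel.homogeneousVanishingIdeal (M r)))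
    (hnested : DiscreteModel.Nested s
      (fun r => DiscreteModel.homogeneousVanishingIdeal (M r)))
    (hCI : ∀ r, ∀ p ∈ M r, DiscreteModel.CondIndep p) :
    DiscreteModel.HasFiniteSymmetricGeneratingSet s
      (fun r => DiscreteModel.homogeneousVanishingIdeal (M r)) :=
  DiscreteModel.hasFiniteSymmetricGeneratingSet_of_swapBinomial_mem hsymm hnested fun r =>
    DiscreteModel.swapBinomial_mem_homogeneousVanishingIdeal (hM r) (hCI r)
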